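/- All vector spaces are real. Let $E$ and $F$ be Hausdorff locally convex spaces with $E\neq\{0\}$, and let $\Phi:E\to F$ be continuous. Write $E^*$, $F^*$ for the topological duals, $\mathcal C(E)$ for the space of continuous functions $E\to\mathbb R$ with the compact-open topology, $P_m(\mathbb R)$ for the set of polynomial functions $\mathbb R\to\mathbb R$ of degree at most $m$, and $\mathrm{Aff}(X,Y)$ for the set of maps $X\to Y$ of the form $x\mapsto Tx+y$ with $T:X\to Y$ continuous and linear and $y\in Y$. The map $\Phi$ is called a polynomial if there are $n\in\mathbb N$, a constant $M_0\in F$ and symmetric maps $M_k:E^k\to F$, $k=1,\dots,n$, linear in each coordinate, such that $\Phi(e)=M_0+M_1(e)+M_2(e,e)+\dots+M_n(e,\dots,e)$ for all $e\in E$. Then the following conditions are equivalent: (i) $\Phi$ is a polynomial; (ii) there is $m\in\mathbb N$ such that $\nu\circ\Phi\circ h\in P_m(\mathbb R)$ for every $\nu\in F^*$ and every $h\in\mathrm{Aff}(\mathbb R,E)$; (iii) $\mathrm{span}\{\nu\circ\Phi\circ g:\ \nu\in F^*,\ g\in\mathrm{Aff}(E,E)\}$ is not dense in $\mathcal C(E)$.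 If, in addition, $E$ is a Baire space and $F^*$ is a Baire space in some vector space topology that is finer than or equal to the weak* topology, then (i), (ii) and (iii) are also equivalent to (iv) $\nu\circ\Phi\circ h$ is a polynomial for every $\nu\in F^*$ and every $h\in\mathrm{Aff}(\mathbb R,E)$ (its degree may depend on $\nu$ and $h$). -/

import Mathlib

/-- `Φ : E → F` is a polynomial of degree at most `n` between real vector spaces: there are
symmetric `k`-linear maps `M k`, `0 ≤ k ≤ n`, with `Φ e = M 0 + M 1 e + ⋯ + M n (e, …, e)`.
The term `k = 0` is a constant (a multilinear map of no variables). No continuity of `M k`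
is required. -/
def IsPolynomialMapOfDegreeLE {E F : Type*} [AddCommGroup E] [Module ℝ E]
    [AddCommGroup F] [Module ℝ F] (n : ℕ) (Φ : E → F) : Prop :=
  ∃ M : (k : ℕ) → MultilinearMap ℝ (fun _ : Fin k => E) F,
    (∀ (k : ℕ) (π : Equiv.Perm (Fin k)) (v : Fin k → E), M k (fun i => v (π i)) = M k v) ∧
    ∀ e : E, Φ e = ∑ k ∈ Finset.range (n + 1), M k (fun _ => e)

/-- `Φ : E → F` is a polynomial (of some degree). -/
def IsPolynomialMap {E F : Type*} [AddCommGroup E] [Module ℝ E]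
    [AddCommGroup F] [Module ℝ F] (Φ : E → F) : Prop :=
  ∃ n : ℕ, IsPolynomialMapOfDegreeLE n Φ

/-- The set `P_m(ℝ)` of the polynomial functions `ℝ → ℝ` of degree at most `m`. -/
def polyFun (m : ℕ) : Set (ℝ → ℝ) :=
  {f | ∃ p : Polynomial ℝ, p.natDegree ≤ m ∧ ∀ t : ℝ, f t = p.eval t}

/-- The set of the continuous functions `ν ∘ Φ ∘ g : E → ℝ` with `ν ∈ F*` and `g` a continuous
affine map `E → E`. -/
def neurons {E F : Type*} [AddCommGroup E] [Module ℝ E] [TopologicalSpace E]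
    [AddCommGroup F] [Module ℝ F] [TopologicalSpace F] (Φ : C(E, F)) : Set C(E, ℝ) :=
  {u | ∃ (ν : StrongDual ℝ F) (g : E →ᴬ[ℝ] E), ∀ x : E, u x = ν (Φ (g x))}

/-- `τ` is a vector space topology on the dual `F*` that is finer than (or equal to) the weak*
topology. -/
structure IsLinearTopologyFinerThanWeakStar {F : Type*} [AddCommGroup F] [Module ℝ F]
    [TopologicalSpace F] (τ : TopologicalSpace (StrongDual ℝ F)) : Prop where
  continuous_add : @ContinuousAdd (StrongDual ℝ F) τ _
  continuous_smul : @ContinuousSMul ℝ (StrongDual ℝ F) _ _ τ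
  le_weakStar : τ ≤ TopologicalSpace.induced
    (fun ν : StrongDual ℝ F => StrongDual.toWeakDual ν) inferInstance

/-! (i) ⇔ (ii): a real polynomial of degree at most `m` is determined by its values at `0, …, m`, so
its derivative at `0` is a fixed linear combination of them. The directional derivative of `Φ` is
thus a finite sum in `F`, without limits (`nodeDeriv`). On `polyOnLines` these operators commute and
are linear in the direction, so Taylor's formula at `0` gives `M k v = D_{v 0} ⋯ D_{v (k-1)} Φ (0) /
k!`.

(ii) ⇒ (iii): restrictions to one line through `0` stay in the closed proper subspace `P_m`.

(iii) ⇒ (ii): suppose no degree works, and let `W` be the closure of the neurons' span on a compact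
`K`. For each `m` some `σ = ν ∘ Φ ∘ h` is not in `P_m`; mollifying and differentiating it puts `u ^
(m + 1)` in `W` for all affine `u` (`pow_succ_mem_of_not_mem_polyFun`). Hence `exp u ∈ W`, and
Stone–Weierstrass gives `W = ⊤`.

(iv) ⇒ (ii): Baire category, applied to directions, base points and functionals in turn, makes the
degree uniform. -/

open Polynomial MeasureTheory Filter Topology

/-! ### Interpolation at `0, …, m`. -/

/-- The Lagrange basis polynomial of index `j` for the nodes `0, 1, …, m`. -/
noncomputable def natLagrange (m j : ℕ) : ℝ[X] :=
  Lagrange.basis (Finset.range (m + 1)) (fun i : ℕ => (i : ℝ)) j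

lemma natDegree_natLagrange {m j : ℕ} (hj : j ∈ Finset.range (m + 1)) :
    (natLagrange m j).natDegree = m := by
  rw [natLagrange, Lagrange.natDegree_basis (Nat.cast_injective.injOn) hj]
  simp

lemma eq_sum_natLagrange {m : ℕ} {p : ℝ[X]} (hp : p.natDegree ≤ m) :
    p = ∑ j ∈ Finset.range (m + 1), C (p.eval (j : ℝ)) * natLagrange m j := by
  have h := Lagrange.eq_interpolate (s := Finset.range (m + 1)) (v := fun i : ℕ => (i : ℝ))
    (f := p) (Nat.cast_injective.injOn) (by
      rw [Finset.card_range]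
      exact lt_of_le_of_lt p.degree_le_natDegree (by exact_mod_cast Nat.lt_succ_of_le hp))
  rw [Lagrange.interpolate_apply] at h
  exact h

lemma natDegree_sum_natLagrange_le (m : ℕ) (c : ℕ → ℝ) :
    (∑ j ∈ Finset.range (m + 1), C (c j) * natLagrange m j).natDegree ≤ m :=
  natDegree_sum_le_of_forall_le _ _ fun _ hj =>
    (natDegree_C_mul_le _ _).trans (natDegree_natLagrange hj).le

/-- Interpolation turns membership into linear identities between point values, so `P_m` is closed
under pointwise limits; all closedness arguments below rest on this. -/
lemma mem_polyFun_iff {m : ℕ} {f : ℝ → ℝ} :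
    f ∈ polyFun m ↔
      ∀ t, f t = ∑ j ∈ Finset.range (m + 1), f j * (natLagrange m j).eval t := by
  constructor
  · rintro ⟨p, hp, h⟩ t
    rw [h t]
    conv_lhs => rw [eq_sum_natLagrange hp]
    simp [eval_finsetSum, h]
  · intro h
    exact ⟨_, natDegree_sum_natLagrange_le m (fun j => f j), fun t => by
      simpa [eval_finsetSum] using h t⟩

lemma polyFun_mono {m n : ℕ} (h : m ≤ n) : polyFun m ⊆ polyFun n :=
  fun _ ⟨p, hp, hf⟩ => ⟨p, hp.trans h, hf⟩

lemma polyFun_add {m : ℕ} {f g : ℝ → ℝ} (hf : f ∈ polyFun m) (hg : g ∈ polyFun m) :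
    (fun t => f t + g t) ∈ polyFun m := by
  obtain ⟨p, hp, hf⟩ := hf
  obtain ⟨q, hq, hg⟩ := hg
  exact ⟨p + q, natDegree_add_le_of_degree_le hp hq, fun t => by simp [hf, hg]⟩

lemma polyFun_const_mul {m : ℕ} {f : ℝ → ℝ} (c : ℝ) (hf : f ∈ polyFun m) :
    (fun t => c * f t) ∈ polyFun m := by
  obtain ⟨p, hp, hf⟩ := hf
  exact ⟨C c * p, (natDegree_C_mul_le _ _).trans hp, fun t => by simp [hf]⟩

lemma zero_mem_polyFun (m : ℕ) : (fun _ => (0 : ℝ)) ∈ polyFun m :=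
  ⟨0, by simp, fun t => by simp⟩

lemma polyFun_sum {m : ℕ} {ι : Type*} (s : Finset ι) {f : ι → ℝ → ℝ}
    (hf : ∀ i ∈ s, f i ∈ polyFun m) : (fun t => ∑ i ∈ s, f i t) ∈ polyFun m := by
  classical
  induction s using Finset.induction_on with
  | empty => simpa using zero_mem_polyFun m
  | insert a s ha ih =>
    simp only [Finset.sum_insert ha]
    exact polyFun_add (hf a (by simp)) (ih fun i hi => hf i (by simp [hi]))

/-! ### Maps polynomial on lines are polynomials. -/

section PolyOnLines

variable {E F : Type*} [AddCommGroup E] [Module ℝ E]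
  [AddCommGroup F] [Module ℝ F]

/-- The derivative in direction `y`, computed by interpolation at `x, x + y, …, x + m y`. -/
noncomputable def nodeDeriv (m : ℕ) (y : E) : (E → F) →ₗ[ℝ] (E → F) where
  toFun Φ x := ∑ j ∈ Finset.range (m + 1),
    (derivative (natLagrange m j)).eval 0 • Φ (x + (j : ℝ) • y)
  map_add' Φ Ψ := by ext x; simp [Finset.sum_add_distrib]
  map_smul' c Φ := by
    ext x; simp [Finset.smul_sum, smul_comm c]

lemma nodeDeriv_apply (m : ℕ) (y : E) (Φ : E → F) (x : E) :
    nodeDeriv m y Φ x = ∑ j ∈ Finset.range (m + 1),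
      (derivative (natLagrange m j)).eval 0 • Φ (x + (j : ℝ) • y) := rfl

lemma nodeDeriv_comm (m : ℕ) (y z : E) (Φ : E → F) :
    nodeDeriv m y (nodeDeriv m z Φ) = nodeDeriv m z (nodeDeriv m y Φ) := by
  ext x
  simp only [nodeDeriv_apply, Finset.smul_sum]
  rw [Finset.sum_comm]
  refine Finset.sum_congr rfl fun i _ => Finset.sum_congr rfl fun j _ => ?_
  rw [smul_comm, add_right_comm]

variable [TopologicalSpace F]

variable (E F) in
/-- The maps `E → F` that are weakly polynomial of degree at most `m` on all lines. -/
def polyOnLines (m : ℕ) : Submodule ℝ (E → F) where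
  carrier := {Φ | ∀ (ν : StrongDual ℝ F) (x y : E), (fun t : ℝ => ν (Φ (x + t • y))) ∈ polyFun m}
  add_mem' hΦ hΨ ν x y := by simpa using polyFun_add (hΦ ν x y) (hΨ ν x y)
  zero_mem' ν x y := by simpa using zero_mem_polyFun m
  smul_mem' c Φ hΦ ν x y := by simpa using polyFun_const_mul c (hΦ ν x y)

lemma dual_nodeDeriv {m : ℕ} {y x : E} {Φ : E → F} {ν : StrongDual ℝ F} {p : ℝ[X]}
    (hp : p.natDegree ≤ m) (h : ∀ t : ℝ, ν (Φ (x + t • y)) = p.eval t) :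
    ν (nodeDeriv m y Φ x) = (derivative p).eval 0 := by
  conv_rhs => rw [eq_sum_natLagrange hp]
  simp [nodeDeriv_apply, eval_finsetSum, h, mul_comm]

lemma nodeDeriv_mem {m : ℕ} (y : E) {Φ : E → F} (hΦ : Φ ∈ polyOnLines E F m) :
    nodeDeriv m y Φ ∈ polyOnLines E F m := by
  intro ν x z
  simp only [nodeDeriv_apply, map_sum, map_smul, smul_eq_mul]
  refine polyFun_sum _ fun j _ => polyFun_const_mul _ ?_
  simpa only [add_right_comm x] using hΦ ν (x + (j : ℝ) • y) z

lemma IsPolynomialMapOfDegreeLE.mem_polyOnLines {n : ℕ} {Φ : E → F}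
    (hΦ : IsPolynomialMapOfDegreeLE n Φ) : Φ ∈ polyOnLines E F n := by
  obtain ⟨M, -, hM⟩ := hΦ
  intro ν x y
  simp only [hM, map_sum]
  refine polyFun_sum _ fun k hk => ?_
  have : ∀ t : ℝ, ν (M k fun _ => x + t • y) = ∑ s : Finset (Fin k),
      ν (M k (s.piecewise (fun _ => y) (fun _ => x))) * t ^ s.card := by
    intro t
    have h1 := (M k).map_add_univ (fun _ => t • y) (fun _ => x)
    have h2 : (fun _ : Fin k => x + t • y) = (fun _ => t • y) + fun _ => x := by
      ext; simp [add_comm]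
    rw [h2, h1, map_sum]
    refine Finset.sum_congr rfl fun s _ => ?_
    have h3 := (M k).map_piecewise_smul (fun _ => t)
      (s.piecewise (fun _ => y) (fun _ => x)) s
    have h4 : s.piecewise (fun i => t • s.piecewise (fun _ => y) (fun _ => x) i)
        (s.piecewise (fun _ => y) (fun _ => x)) =
        s.piecewise (fun _ => t • y) (fun _ : Fin k => x) := by
      ext i
      by_cases hi : i ∈ s <;> simp [hi]
    rw [h4] at h3
    rw [h3]
    simp [mul_comm]
  simp only [this]
  refine polyFun_sum _ fun s _ => polyFun_const_mul _ ⟨X ^ s.card, ?_, fun t => by simp⟩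
  rw [natDegree_X_pow]
  have := s.card_le_univ
  have := Finset.mem_range.1 hk
  simp at *
  omega

variable [SeparatingDual ℝ F]

lemma eq_of_forall_dual_eq {u v : F} (h : ∀ ν : StrongDual ℝ F, ν u = ν v) : u = v := by
  by_contra hne
  obtain ⟨ν, hν⟩ := SeparatingDual.exists_separating_of_ne (R := ℝ) hne
  exact hν (h ν)

lemma nodeDeriv_smul_dir {m : ℕ} {Φ : E → F} (hΦ : Φ ∈ polyOnLines E F m) (a : ℝ) (y : E) :
    nodeDeriv m (a • y) Φ = a • nodeDeriv m y Φ := by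
  ext x
  refine eq_of_forall_dual_eq fun ν => ?_
  obtain ⟨p, hp, h⟩ := hΦ ν x y
  rw [Pi.smul_apply, map_smul, dual_nodeDeriv hp h,
    dual_nodeDeriv (p := p.comp (C a * X)) _ _]
  · simp [derivative_comp]
  · refine natDegree_comp_le.trans ?_
    exact (Nat.mul_le_mul hp ((natDegree_C_mul_le _ _).trans natDegree_X_le)).trans (mul_one m).le
  · intro t
    rw [smul_smul, mul_comm t a, eval_comp, eval_mul, eval_C, eval_X]
    exact h (a * t)

/-- With `L_j` the Lagrange basis, `ν (Φ (x + s • y + t • z)) = ∑ r_j(t) L_j(s)` is a polynomial in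
two variables. The product rule on the diagonal `s = t` splits its derivative at `0` into those
along `y` and `z`. -/
lemma nodeDeriv_add_dir {m : ℕ} {Φ : E → F} (hΦ : Φ ∈ polyOnLines E F m) (y z : E) :
    nodeDeriv m (y + z) Φ = nodeDeriv m y Φ + nodeDeriv m z Φ := by
  ext x
  refine eq_of_forall_dual_eq fun ν => ?_
  choose r hr hrt using fun w : E => hΦ ν w z
  have hq : ∀ w : E, ∀ s : ℝ, ν (Φ (w + s • y)) =
      ∑ j ∈ Finset.range (m + 1), ν (Φ (w + (j : ℝ) • y)) * (natLagrange m j).eval s :=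
    fun w => mem_polyFun_iff.1 (hΦ ν w y)
  obtain ⟨p, hp, hpt⟩ := hΦ ν x (y + z)
  have hP : p = ∑ j ∈ Finset.range (m + 1), r (x + (j : ℝ) • y) * natLagrange m j := by
    refine Polynomial.funext fun t => ?_
    refine (hpt t).symm.trans ?_
    beta_reduce
    rw [smul_add, add_comm (t • y), ← add_assoc, hq, eval_finsetSum]
    refine Finset.sum_congr rfl fun j _ => ?_
    rw [eval_mul, ← hrt, add_right_comm]
  have hy : ν (nodeDeriv m y Φ x) = (derivative (∑ j ∈ Finset.range (m + 1),
      C (ν (Φ (x + (j : ℝ) • y))) * natLagrange m j)).eval 0 :=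
    dual_nodeDeriv (natDegree_sum_natLagrange_le m _) fun t => by
      simpa [eval_finsetSum] using hq x t
  have hz : ν (nodeDeriv m z Φ x) = (derivative (∑ j ∈ Finset.range (m + 1),
      C ((natLagrange m j).eval 0) * r (x + (j : ℝ) • y))).eval 0 := by
    refine dual_nodeDeriv (natDegree_sum_le_of_forall_le _ _ fun j _ =>
      (natDegree_C_mul_le _ _).trans (hr _)) fun t => ?_
    have := hq (x + t • z) 0
    rw [zero_smul, add_zero] at this
    rw [this, eval_finsetSum]
    refine Finset.sum_congr rfl fun j _ => ?_
    rw [eval_mul, eval_C, mul_comm, ← hrt, add_right_comm]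
  have hr0 : ∀ w, (r w).eval 0 = ν (Φ w) := fun w => by simpa using (hrt w 0).symm
  rw [Pi.add_apply, map_add, dual_nodeDeriv hp hpt, hP, hy, hz]
  simp only [derivative_sum, derivative_mul, derivative_C, eval_finsetSum, eval_add, eval_mul,
    eval_C, zero_mul, zero_add, ← Finset.sum_add_distrib, hr0]
  exact Finset.sum_congr rfl fun j _ => by ring

variable (E F) in
/-- The directional derivative on `polyOnLines E F m`, as a linear function of the direction. -/
noncomputable def dirDeriv (m : ℕ) : E →ₗ[ℝ] Module.End ℝ (polyOnLines E F m) where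
  toFun y := (nodeDeriv m y).restrict fun _ hΦ => nodeDeriv_mem y hΦ
  map_add' y z := by
    ext Φ : 2
    exact nodeDeriv_add_dir Φ.2 y z
  map_smul' a y := by
    ext Φ : 2
    exact nodeDeriv_smul_dir Φ.2 a y

lemma dirDeriv_commute (m : ℕ) (y z : E) : Commute (dirDeriv E F m y) (dirDeriv E F m z) := by
  ext Φ : 2
  exact nodeDeriv_comm m y z Φ.1

lemma dual_dirDeriv_pow {m : ℕ} (e : E) (k : ℕ) {Φ : polyOnLines E F m} {ν : StrongDual ℝ F}
    {p : ℝ[X]} (hp : p.natDegree ≤ m) (h : ∀ t : ℝ, ν (Φ.1 (t • e)) = p.eval t) (t : ℝ) :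
    ν (((dirDeriv E F m e ^ k) Φ).1 (t • e)) = (derivative^[k] p).eval t := by
  induction k generalizing t with
  | zero => simpa using h t
  | succ k ih =>
    rw [pow_succ', Function.iterate_succ_apply']
    refine (dual_nodeDeriv (p := (derivative^[k] p).comp (X + C t)) ?_ fun s => ?_).trans ?_
    · refine natDegree_comp_le.trans ?_
      rw [natDegree_X_add_C, mul_one]
      exact (natDegree_iterate_derivative _ _).trans ((Nat.sub_le _ _).trans hp)
    · rw [← add_smul]
      refine (ih _).trans ?_
      simp [add_comm]
    · simp [derivative_comp]

lemma eq_sum_dirDeriv {m : ℕ} (Φ : polyOnLines E F m) (e : E) :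
    Φ.1 e = ∑ k ∈ Finset.range (m + 1),
      ((k.factorial : ℝ)⁻¹) • ((dirDeriv E F m e ^ k) Φ).1 0 := by
  refine eq_of_forall_dual_eq fun ν => ?_
  obtain ⟨p, hp, h⟩ := Φ.2 ν 0 e
  simp only [zero_add] at h
  have h1 := h 1
  rw [one_smul] at h1
  rw [h1, eval_eq_sum_range' (Nat.lt_succ_of_le hp), map_sum]
  refine Finset.sum_congr rfl fun k _ => ?_
  have := dual_dirDeriv_pow e k hp h 0
  rw [zero_smul] at this
  rw [map_smul, this, ← coeff_zero_eq_eval_zero, coeff_iterate_derivative]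
  have hk : (k.factorial : ℝ) ≠ 0 := by positivity
  simp [Nat.descFactorial_self, hk]

theorem isPolynomialMapOfDegreeLE_of_mem_polyOnLines {m : ℕ} {Φ : E → F}
    (hΦ : Φ ∈ polyOnLines E F m) : IsPolynomialMapOfDegreeLE m Φ := by
  let ev : Module.End ℝ (polyOnLines E F m) →ₗ[ℝ] F :=
    LinearMap.proj (0 : E) ∘ₗ (polyOnLines E F m).subtype ∘ₗ LinearMap.applyₗ ⟨Φ, hΦ⟩
  refine ⟨fun k => ((k.factorial : ℝ)⁻¹) • ev.compMultilinearMap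
    ((MultilinearMap.mkPiAlgebraFin ℝ k (Module.End ℝ (polyOnLines E F m))).compLinearMap
      fun _ => dirDeriv E F m), fun k π v => ?_, fun e => ?_⟩
  -- Symmetry: permuting the arguments permutes commuting factors.
  · have : (List.ofFn fun i => dirDeriv E F m (v (π i))).prod =
        (List.ofFn fun i => dirDeriv E F m (v i)).prod := by
      refine List.Perm.prod_eq' (Equiv.Perm.ofFn_comp_perm π fun i => dirDeriv E F m (v i)) ?_
      rw [List.pairwise_ofFn]
      exact fun _ _ _ => dirDeriv_commute m _ _
    simp [this]
  · refine (eq_sum_dirDeriv (⟨Φ, hΦ⟩ : polyOnLines E F m) e).trans ?_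
    refine Finset.sum_congr rfl fun k _ => ?_
    simp [ev]

end PolyOnLines

/-! ### Antiderivatives and limits of polynomial functions. -/

section Primitives

lemma mem_polyFun_of_hasDerivAt {m : ℕ} {f f' : ℝ → ℝ} (hf : ∀ t, HasDerivAt f (f' t) t)
    (hf' : f' ∈ polyFun m) : f ∈ polyFun (m + 1) := by
  obtain ⟨p, hp, hpt⟩ := hf'
  let q : ℝ[X] := ∑ k ∈ Finset.range (m + 1), C (p.coeff k / (k + 1)) * X ^ (k + 1)
  have hq : q.natDegree ≤ m + 1 := natDegree_sum_le_of_forall_le _ _ fun k hk =>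
    (natDegree_C_mul_X_pow_le _ _).trans (Finset.mem_range.1 hk)
  have hqp : derivative q = p := by
    conv_rhs => rw [p.as_sum_range_C_mul_X_pow' (Nat.lt_succ_of_le hp)]
    simp only [q, derivative_sum, derivative_C_mul_X_pow]
    refine Finset.sum_congr rfl fun k _ => ?_
    have : (k : ℝ) + 1 ≠ 0 := by positivity
    simp [div_mul_cancel₀ _ this]
  have hconst : ∀ t, f t - q.eval t = f 0 - q.eval 0 := fun t => by
    have hd : ∀ s, HasDerivAt (fun s => f s - q.eval s) 0 s := fun s => by
      have := (hf s).sub (q.hasDerivAt s)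
      rwa [hqp, hpt, sub_self] at this
    exact is_const_of_deriv_eq_zero (fun s => (hd s).differentiableAt) (fun s => (hd s).deriv) t 0
  refine ⟨q + C (f 0 - q.eval 0), ?_, fun t => ?_⟩
  · rwa [natDegree_add_C]
  · simp [← hconst t]

lemma mem_polyFun_of_iterated_hasDerivAt_eq_zero (m : ℕ) (g : ℕ → ℝ → ℝ)
    (hg : ∀ k t, HasDerivAt (g k) (g (k + 1) t) t) (h0 : ∀ t, g (m + 1) t = 0) :
    g 0 ∈ polyFun m := by
  induction m generalizing g with
  | zero =>
    have hd : ∀ s, HasDerivAt (g 0) 0 s := fun s => by simpa [h0] using hg 0 s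
    exact ⟨C (g 0 0), by simp, fun t => by
      simpa using is_const_of_deriv_eq_zero (fun s => (hd s).differentiableAt)
        (fun s => (hd s).deriv) t 0⟩
  | succ m ih =>
    exact mem_polyFun_of_hasDerivAt (hg 0) (ih (fun k => g (k + 1)) (fun k t => hg _ t) h0)

lemma polyFun_of_tendsto {m : ℕ} {g : ℕ → ℝ → ℝ} {f : ℝ → ℝ} (hg : ∀ n, g n ∈ polyFun m)
    (h : ∀ t, Tendsto (fun n => g n t) atTop (𝓝 (f t))) : f ∈ polyFun m := by
  rw [mem_polyFun_iff]
  intro t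
  refine tendsto_nhds_unique (h t) ?_
  simp only [fun n => mem_polyFun_iff.1 (hg n) t]
  exact tendsto_finsetSum _ fun j _ => (h j).mul_const _

end Primitives

/-! ### Integrals and derivatives in closed subspaces. -/

section ClosedSubmodule

variable {X : Type*} [NormedAddCommGroup X] [NormedSpace ℝ X] {W : Submodule ℝ X}

/-- The integrand vanishes in the quotient by `W`, hence so does the integral. A non-integrable `f`
has integral `0` by convention. -/
lemma Submodule.integral_mem_of_isClosed [CompleteSpace X] (hW : IsClosed (W : Set X))
    {α : Type*} [MeasurableSpace α] {μ : Measure α} {f : α → X} (hf : ∀ a, f a ∈ W) :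
    ∫ a, f a ∂μ ∈ W := by
  by_cases hi : Integrable f μ
  · have : IsClosed (W : Set X) := hW
    have h := (W.mkQL).integral_comp_comm hi
    have h0 : ∀ a, W.mkQL (f a) = 0 := fun a => (Submodule.Quotient.mk_eq_zero W).2 (hf a)
    simp only [h0, integral_zero] at h
    exact (Submodule.Quotient.mk_eq_zero W).1 h.symm
  · rw [integral_undef hi]
    exact W.zero_mem

lemma Submodule.deriv_mem_of_isClosed (hW : IsClosed (W : Set X)) {c : ℝ → X} {c' : X} {a : ℝ}
    (hc : ∀ s, c s ∈ W) (h : HasDerivAt c c' a) : c' ∈ W :=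
  hW.mem_of_tendsto (hasDerivAt_iff_tendsto_slope.1 h) <| Eventually.of_forall fun s =>
    W.smul_mem _ (W.sub_mem (hc s) (hc a))

end ClosedSubmodule

/-! ### Closed subspaces of `C(K, ℝ)` generated by ridge functions. -/

section Compact

variable {K : Type*} [TopologicalSpace K] [CompactSpace K]

/-- The curve is the integral of a continuous curve in `C(K, ℝ)`, so the fundamental theorem of
calculus gives differentiability in the sup norm. -/
lemma hasDerivAt_continuousMap_comp (f f' : C(ℝ, ℝ)) (hf : ∀ t, HasDerivAt f (f' t) t)
    (l u : C(K, ℝ)) : HasDerivAt (fun s : ℝ => f.comp (l + s • u)) (f'.comp l * u) 0 := by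
  let c : C(ℝ, C(K, ℝ)) := ContinuousMap.curry
    ⟨fun q : ℝ × K => f' (l q.2 + q.1 * u q.2) * u q.2, by fun_prop⟩
  have hc : ∀ s x, c s x = f' (l x + s * u x) * u x := fun s x => rfl
  have hint : ∀ s : ℝ, f.comp (l + s • u) = f.comp l + ∫ r in (0 : ℝ)..s, c r := fun s => by
    ext x
    have h1 := (ContinuousMap.evalCLM (R := ℝ) (M := ℝ) x).intervalIntegral_comp_comm
      (c.continuous.intervalIntegrable (μ := volume) 0 s)
    have h2 : ∫ r in (0 : ℝ)..s, f' (l x + r * u x) * u x =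
        f (l x + s * u x) - f (l x + 0 * u x) := by
      refine intervalIntegral.integral_eq_sub_of_hasDerivAt
        (f := fun r => f (l x + r * u x)) (fun r _ => ?_) ?_
      · have := (hf (l x + r * u x)).comp r (((hasDerivAt_id r).mul_const (u x)).const_add (l x))
        simpa [Function.comp_def] using this
      · exact Continuous.intervalIntegrable (by fun_prop) _ _
    have h3 : (∫ r in (0 : ℝ)..s, c r) x = ∫ r in (0 : ℝ)..s, f' (l x + r * u x) * u x := h1.symm
    simp [h3, h2]
  have hd := (c.continuous.integral_hasStrictDerivAt 0 0).hasDerivAt.const_add (f.comp l)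
  have hc0 : c 0 = f'.comp l * u := by
    ext x; simp [hc]
  rw [hc0] at hd
  simpa only [hint] using hd

variable {W : Submodule ℝ C(K, ℝ)} {A : Submodule ℝ C(K, ℝ)}

/-- Differentiating `g k ∘ (l + s • u) * u ^ k` at `s = 0` raises `k` by one and stays in the closed
`W`. -/
lemma iterated_deriv_comp_mul_pow_mem (hW : IsClosed (W : Set C(K, ℝ))) {g : ℕ → C(ℝ, ℝ)}
    (hg : ∀ k t, HasDerivAt (g k) (g (k + 1) t) t) (h0 : ∀ l ∈ A, (g 0).comp l ∈ W)
    {u : C(K, ℝ)} (hu : u ∈ A) (k : ℕ) : ∀ l ∈ A, (g k).comp l * u ^ k ∈ W := by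
  induction k with
  | zero => simpa using h0
  | succ k ih =>
    intro l hl
    have := (hasDerivAt_continuousMap_comp (g k) (g (k + 1)) (hg k) l u).mul_const (u ^ k)
    rw [mul_assoc, ← pow_succ'] at this
    exact Submodule.deriv_mem_of_isClosed hW
      (fun s => ih _ (A.add_mem hl (A.smul_mem s hu))) this

open scoped Convolution ContDiff

/-- `g ∘ l` is a `C(K, ℝ)`-valued integral of multiples of `σ ∘ (l - t)`, where `l - t ∈ A` because
`A` contains the constants. -/
lemma convolution_comp_mem (hW : IsClosed (W : Set C(K, ℝ)))
    (hA : ∀ c : ℝ, ContinuousMap.const K c ∈ A) {σ : C(ℝ, ℝ)} (hσ : ∀ l ∈ A, σ.comp l ∈ W)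
    {ρ : ℝ → ℝ} (hρ : Continuous ρ) (hρc : HasCompactSupport ρ) {g : C(ℝ, ℝ)}
    (hg : ∀ t, g t = (ρ ⋆[ContinuousLinearMap.lsmul ℝ ℝ, volume] σ) t) {l : C(K, ℝ)}
    (hl : l ∈ A) : g.comp l ∈ W := by
  let c : C(ℝ, C(K, ℝ)) := ContinuousMap.curry ⟨fun q : ℝ × K => σ (l q.2 - q.1), by fun_prop⟩
  have hc : ∀ t, c t = σ.comp (l - ContinuousMap.const K t) := fun t => rfl
  have hcont : Continuous fun t => ρ t • c t := hρ.smul c.continuous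
  have hint : Integrable fun t => ρ t • c t :=
    hcont.integrable_of_hasCompactSupport hρc.smul_right
  have : g.comp l = ∫ t, ρ t • c t := by
    ext x
    have h1 := (ContinuousMap.evalCLM (R := ℝ) (M := ℝ) x).integral_comp_comm hint
    have h2 : (∫ t, ρ t • c t) x = ∫ t, ρ t * σ (l x - t) := h1.symm
    rw [h2, ContinuousMap.comp_apply, hg, convolution_def]
    rfl
  rw [this]
  exact Submodule.integral_mem_of_isClosed hW fun t =>
    W.smul_mem _ (hσ _ (A.sub_mem hl (hA t)))

theorem pow_succ_mem_of_not_mem_polyFun (hW : IsClosed (W : Set C(K, ℝ)))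
    (hA : ∀ c : ℝ, ContinuousMap.const K c ∈ A) {σ : C(ℝ, ℝ)} (hσ : ∀ l ∈ A, σ.comp l ∈ W)
    {m : ℕ} (hm : ⇑σ ∉ polyFun m) {u : C(K, ℝ)} (hu : u ∈ A) : u ^ (m + 1) ∈ W := by
  let φ : ℕ → ContDiffBump (0 : ℝ) := fun n =>
    ⟨1 / ((n : ℝ) + 1) / 2, 1 / ((n : ℝ) + 1), by positivity, half_lt_self (by positivity)⟩
  have hφ : Tendsto (fun n => (φ n).rOut) atTop (𝓝 0) := tendsto_one_div_add_atTop_nhds_zero_nat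
  let G : ℕ → ℝ → ℝ := fun n => (φ n).normed volume ⋆[ContinuousLinearMap.lsmul ℝ ℝ, volume] σ
  have hG : ∀ n, ContDiff ℝ ∞ (G n) := fun n =>
    (φ n).hasCompactSupport_normed.contDiff_convolution_left _ (φ n).contDiff_normed
      σ.continuous.locallyIntegrable
  have hlim : ∀ t, Tendsto (fun n => G n t) atTop (𝓝 (σ t)) := fun t =>
    ContDiffBump.convolution_tendsto_right_of_continuous hφ σ.continuous t
  -- Otherwise `σ`, the pointwise limit of the mollifications, would lie in `P_m`.
  obtain ⟨n, hn⟩ : ∃ n, G n ∉ polyFun m := by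
    by_contra! h
    exact hm (polyFun_of_tendsto h hlim)
  let g : ℕ → C(ℝ, ℝ) := fun k =>
    ⟨iteratedDeriv k (G n), (hG n).continuous_iteratedDeriv k (by exact_mod_cast le_top)⟩
  have hg : ∀ k t, HasDerivAt (g k) (g (k + 1) t) t := fun k t => by
    have := ((hG n).differentiable_iteratedDeriv k (by exact_mod_cast WithTop.coe_lt_top _) t).hasDerivAt
    simpa [g, iteratedDeriv_succ] using this
  have hg0 : ⇑(g 0) = G n := by simp [g]
  obtain ⟨b, hb⟩ : ∃ b, g (m + 1) b ≠ 0 := by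
    by_contra! h
    exact hn (hg0 ▸ mem_polyFun_of_iterated_hasDerivAt_eq_zero m (fun k => g k) hg h)
  -- At the constant `l = b` the derivative factor is a nonzero scalar, leaving `u ^ (m + 1)`.
  have hmem := iterated_deriv_comp_mul_pow_mem hW hg (fun l hl => convolution_comp_mem hW hA hσ
    (φ n).continuous_normed (φ n).hasCompactSupport_normed (congrFun hg0) hl) hu (m + 1) _ (hA b)
  have : u ^ (m + 1) = (g (m + 1) b)⁻¹ •
      ((g (m + 1)).comp (ContinuousMap.const K b) * u ^ (m + 1)) := by
    ext x
    simp [hb]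
  rw [this]
  exact W.smul_mem _ hmem

/-- The pointwise exponential of a continuous function. -/
noncomputable def expComp (u : C(K, ℝ)) : C(K, ℝ) := ⟨fun x => Real.exp (u x), by fun_prop⟩

lemma expComp_mem (hW : IsClosed (W : Set C(K, ℝ))) {u : C(K, ℝ)} (hu : ∀ k : ℕ, u ^ k ∈ W) :
    expComp u ∈ W := by
  have hs : Summable fun k : ℕ => ((k.factorial : ℝ)⁻¹) • u ^ k :=
    NormedSpace.expSeries_summable' (𝕂 := ℝ) u
  have : expComp u = ∑' k : ℕ, ((k.factorial : ℝ)⁻¹) • u ^ k := by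
    ext x
    have h := (ContinuousMap.evalCLM (R := ℝ) (M := ℝ) x).map_tsum hs
    have h' : (∑' k : ℕ, ((k.factorial : ℝ)⁻¹) • u ^ k) x =
        ∑' k : ℕ, ((k.factorial : ℝ)⁻¹) • (u x) ^ k := h
    rw [h', ← congrFun (NormedSpace.exp_eq_tsum (𝔸 := ℝ) ℝ) (u x), ← Real.exp_eq_exp_ℝ]
    rfl
  rw [this]
  refine hW.mem_of_tendsto hs.hasSum (Eventually.of_forall fun s => ?_)
  exact W.sum_mem fun k _ => W.smul_mem _ (hu k)

/-- As `exp u * exp v = exp (u + v)`, the linear span of the exponentials is already an algebra, and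
Stone–Weierstrass applies although `W` need not be closed under products. -/
theorem eq_top_of_forall_pow_mem (hW : IsClosed (W : Set C(K, ℝ)))
    (hsep : ∀ x y : K, x ≠ y → ∃ u ∈ A, u x ≠ u y) (h : ∀ u ∈ A, ∀ k : ℕ, u ^ k ∈ W) :
    W = ⊤ := by
  let S : Submonoid C(K, ℝ) :=
    { carrier := expComp '' A
      one_mem' := ⟨0, A.zero_mem, by ext; simp [expComp]⟩
      mul_mem' := by
        rintro _ _ ⟨u, hu, rfl⟩ ⟨v, hv, rfl⟩
        exact ⟨u + v, A.add_mem hu hv, by ext; simp [expComp, Real.exp_add]⟩ }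
  have hle : Subalgebra.toSubmodule (Algebra.adjoin ℝ (S : Set C(K, ℝ))) ≤ W := by
    rw [Algebra.adjoin_eq_span, Submonoid.closure_eq, Submodule.span_le]
    rintro _ ⟨u, hu, rfl⟩
    exact expComp_mem hW (h u hu)
  have htop := ContinuousMap.subalgebra_topologicalClosure_eq_top_of_separatesPoints
    (Algebra.adjoin ℝ (S : Set C(K, ℝ))) fun x y hxy => by
      obtain ⟨u, hu, hne⟩ := hsep x y hxy
      exact ⟨expComp u, ⟨expComp u, Algebra.subset_adjoin ⟨u, hu, rfl⟩, rfl⟩,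
        fun he => hne (Real.exp_injective he)⟩
  refine eq_top_iff.2 fun f _ => ?_
  have hf : f ∈ (Algebra.adjoin ℝ (S : Set C(K, ℝ))).topologicalClosure := htop ▸ Algebra.mem_top
  exact closure_minimal (fun v hv => hle hv) hW hf

end Compact

/-! ### Uniform degree bounds by Baire category. -/

section Baire

lemma polyFun_eq_of_eventuallyEq {m n : ℕ} {f g : ℝ → ℝ} (hf : f ∈ polyFun m)
    (hg : g ∈ polyFun n) {a : ℝ} (h : ∀ᶠ t in 𝓝 a, f t = g t) (t : ℝ) : f t = g t := by
  obtain ⟨p, -, hp⟩ := hf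
  obtain ⟨q, -, hq⟩ := hg
  have : p = q := eq_of_infinite_eval_eq p q <|
    (infinite_of_mem_nhds a h).mono fun s (hs : f s = g s) => by
      simpa [← hp, ← hq] using hs
  rw [hp, hq, this]

/-- In a Baire topological vector space, if a countable closed cover consists of sets `B` such
that `x + v ∈ B` whenever `x + a • v ∈ B` for all small `a`, then one of the sets is everything. -/
lemma exists_forall_mem_of_iUnion_eq_univ {V : Type*} [AddCommGroup V] [Module ℝ V]
    [TopologicalSpace V] [ContinuousAdd V] [ContinuousSMul ℝ V] [BaireSpace V]
    {B : ℕ → Set V} (hB : ∀ n, IsClosed (B n)) (hU : ⋃ n, B n = Set.univ)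
    (hline : ∀ n x v, (∀ᶠ a in 𝓝 (0 : ℝ), x + a • v ∈ B n) → x + v ∈ B n) :
    ∃ n, ∀ y, y ∈ B n := by
  obtain ⟨n, x, hx⟩ := nonempty_interior_of_iUnion_of_closed hB hU
  refine ⟨n, fun y => ?_⟩
  have hc : Tendsto (fun a : ℝ => x + a • (y - x)) (𝓝 0) (𝓝 x) := by
    have : Continuous fun a : ℝ => x + a • (y - x) := by fun_prop
    simpa using this.tendsto 0
  simpa using hline n x (y - x) (hc.eventually (mem_interior_iff_mem_nhds.1 hx))

variable {E : Type*} [AddCommGroup E] [Module ℝ E] [TopologicalSpace E] [ContinuousAdd E]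
  [ContinuousSMul ℝ E]

lemma isClosed_setOf_mem_polyFun {Y : Type*} [TopologicalSpace Y] (m : ℕ) {f : Y → ℝ → ℝ}
    (hf : ∀ t, Continuous fun y => f y t) : IsClosed {y | f y ∈ polyFun m} := by
  simp only [mem_polyFun_iff, Set.ofPred_forall]
  exact isClosed_iInter fun t => isClosed_eq (hf t) (by fun_prop)

/-- If `f a t` is a polynomial in `a` for each `t`, and a polynomial in `t` of degree at most `m`
for all small `a`, then it is a polynomial in `t` of degree at most `m` for every `a`. -/
lemma mem_polyFun_of_eventually {f : ℝ → ℝ → ℝ} {m : ℕ}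
    (hp : ∀ t, ∃ n, (fun a => f a t) ∈ polyFun n)
    (h : ∀ᶠ a in 𝓝 (0 : ℝ), f a ∈ polyFun m) (a : ℝ) : f a ∈ polyFun m := by
  choose n hn using hp
  rw [mem_polyFun_iff]
  intro t
  let N := (Finset.range (m + 1)).sup fun j => n j
  -- For fixed `t`, both sides of the interpolation identity are polynomials in `a`; agreeing near
  -- `0`, they agree everywhere.
  have hr : (fun a => ∑ j ∈ Finset.range (m + 1), f a j * (natLagrange m j).eval t) ∈
      polyFun N := by
    refine polyFun_sum _ fun j hj => ?_
    simp only [mul_comm (f _ _)]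
    exact polyFun_const_mul _ (polyFun_mono (Finset.le_sup (f := fun j : ℕ => n j) hj) (hn j))
  exact polyFun_eq_of_eventuallyEq (hn t) hr (h.mono fun a ha => mem_polyFun_iff.1 ha t) a

/-- Baire is used twice: over directions `y` for a fixed `x`, then over `x`. -/
theorem exists_degree_bound_of_polynomial_on_lines [BaireSpace E] {φ : E → ℝ} (hφ : Continuous φ)
    (h : ∀ x y : E, ∃ m, (fun t : ℝ => φ (x + t • y)) ∈ polyFun m) :
    ∃ m, ∀ x y : E, (fun t : ℝ => φ (x + t • y)) ∈ polyFun m := by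
  have h1 : ∀ x : E, ∃ m, ∀ y : E, (fun t : ℝ => φ (x + t • y)) ∈ polyFun m := by
    intro x
    obtain ⟨m, hm⟩ := exists_forall_mem_of_iUnion_eq_univ
      (B := fun m => {y : E | (fun t : ℝ => φ (x + t • y)) ∈ polyFun m})
      (fun m => isClosed_setOf_mem_polyFun m fun t => by fun_prop)
      (Set.eq_univ_of_forall fun y => Set.mem_iUnion.2 (h x y)) (fun m y v hyv => by
        have := mem_polyFun_of_eventually (f := fun a t => φ (x + t • (y + a • v)))
          (fun t => by
            obtain ⟨n, hn⟩ := h (x + t • y) (t • v)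
            refine ⟨n, ?_⟩
            simpa only [smul_add, add_assoc, smul_comm t] using hn) hyv 1
        simpa using this)
    exact ⟨m, hm⟩
  obtain ⟨m, hm⟩ := exists_forall_mem_of_iUnion_eq_univ
    (B := fun m => {x : E | ∀ y : E, (fun t : ℝ => φ (x + t • y)) ∈ polyFun m})
    (fun m => by
      simp only [Set.ofPred_forall]
      exact isClosed_iInter fun y => isClosed_setOf_mem_polyFun m fun t => by fun_prop)
    (Set.eq_univ_of_forall fun x => Set.mem_iUnion.2 (h1 x)) (fun m x v hxv y => by
      have := mem_polyFun_of_eventually (f := fun a t => φ (x + a • v + t • y))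
        (fun t => by
          obtain ⟨n, hn⟩ := h (x + t • y) v
          refine ⟨n, ?_⟩
          simpa only [add_right_comm x] using hn) (hxv.mono fun a ha => ha y) 1
      simpa using this)
  exact ⟨m, hm⟩

variable {F : Type*} [AddCommGroup F] [Module ℝ F] [TopologicalSpace F]

lemma IsLinearTopologyFinerThanWeakStar.continuous_eval {τ : TopologicalSpace (StrongDual ℝ F)}
    (hτ : IsLinearTopologyFinerThanWeakStar τ) (z : F) :
    @Continuous _ _ τ _ fun ν : StrongDual ℝ F => ν z := by
  have h1 : @Continuous _ _ τ _ fun ν : StrongDual ℝ F => StrongDual.toWeakDual ν :=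
    continuous_iff_le_induced.2 hτ.le_weakStar
  exact (WeakDual.eval_continuous z).comp h1

theorem exists_mem_polyOnLines_of_baire [BaireSpace E] {τ : TopologicalSpace (StrongDual ℝ F)}
    (hτ : IsLinearTopologyFinerThanWeakStar τ) (hB : @BaireSpace (StrongDual ℝ F) τ)
    {Φ : E → F} (hΦ : Continuous Φ)
    (h : ∀ (ν : StrongDual ℝ F) (x y : E), ∃ m, (fun t : ℝ => ν (Φ (x + t • y))) ∈ polyFun m) :
    ∃ m, Φ ∈ polyOnLines E F m := by
  have h1 : ∀ ν : StrongDual ℝ F, ∃ m, ∀ x y : E, (fun t : ℝ => ν (Φ (x + t • y))) ∈ polyFun m :=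
    fun ν => exists_degree_bound_of_polynomial_on_lines (φ := fun x => ν (Φ x)) (by fun_prop) (h ν)
  obtain ⟨m, hm⟩ := @exists_forall_mem_of_iUnion_eq_univ (StrongDual ℝ F) _ _ τ hτ.continuous_add
    hτ.continuous_smul hB
    (fun m => {ν | ∀ x y : E, (fun t : ℝ => ν (Φ (x + t • y))) ∈ polyFun m})
    (fun m => by
      simp only [Set.ofPred_forall]
      refine @isClosed_iInter _ _ τ _ fun x => @isClosed_iInter _ _ τ _ fun y => ?_
      exact @isClosed_setOf_mem_polyFun _ τ m (fun ν t => ν (Φ (x + t • y)))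
        fun t => hτ.continuous_eval _)
    (Set.eq_univ_of_forall fun ν => Set.mem_iUnion.2 (h1 ν)) (fun m ν w hw x y => by
      -- `a = 0` handles `ν`, a small `a ≠ 0` handles `ν + a • w`, and `ν + w = (1 - a⁻¹) • ν + a⁻¹
      -- • (ν + a • w)`.
      have h0 : (fun t : ℝ => ν (Φ (x + t • y))) ∈ polyFun m := by
        simpa using hw.self_of_nhds x y
      have hev : ∀ᶠ a in 𝓝[≠] (0 : ℝ), ∀ x y : E,
          (fun t : ℝ => (ν + a • w) (Φ (x + t • y))) ∈ polyFun m :=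
        hw.filter_mono nhdsWithin_le_nhds
      obtain ⟨a, ha, ha0⟩ := (hev.and self_mem_nhdsWithin).exists
      have ha0 : a ≠ 0 := ha0
      have h2 := polyFun_add (polyFun_const_mul (1 - a⁻¹) h0) (polyFun_const_mul a⁻¹ (ha x y))
      convert h2 using 2 with t
      simp
      field_simp
      ring)
  exact ⟨m, hm⟩

end Baire

/-! ### Density and non-density of the neurons. -/

section Density

variable {E F : Type*} [AddCommGroup E] [Module ℝ E] [TopologicalSpace E]
  [IsTopologicalAddGroup E] [ContinuousSMul ℝ E]
  [AddCommGroup F] [Module ℝ F] [TopologicalSpace F]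

lemma forall_continuousAffineMap_iff {P : (ℝ → E) → Prop} :
    (∀ h : ℝ →ᴬ[ℝ] E, P fun t => h t) ↔ ∀ x y : E, P fun t => x + t • y := by
  constructor
  · intro H x y
    have := H ((ContinuousLinearMap.toSpanSingleton ℝ y).toContinuousAffineMap +
      ContinuousAffineMap.const ℝ ℝ x)
    convert this using 2 with t
    simp [add_comm]
  · intro H h
    have := H (h 0) (h.contLinear 1)
    convert this using 2 with t
    have h1 := h.map_vadd 0 t
    have h2 := h.contLinear.map_smul t 1
    simp only [smul_eq_mul, mul_one] at h2
    rw [← h2]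
    simpa [add_comm] using h1

lemma mem_polyOnLines_iff {m : ℕ} {Φ : E → F} : Φ ∈ polyOnLines E F m ↔
    ∀ (ν : StrongDual ℝ F) (h : ℝ →ᴬ[ℝ] E), (fun t => ν (Φ (h t))) ∈ polyFun m :=
  forall_congr' fun ν => (forall_continuousAffineMap_iff
    (P := fun l => (fun t => ν (Φ (l t))) ∈ polyFun m)).symm

variable [SeparatingDual ℝ E]

theorem not_dense_span_neurons [Nontrivial E] {m : ℕ} {Φ : C(E, F)}
    (hΦ : ⇑Φ ∈ polyOnLines E F m) : ¬ Dense (Submodule.span ℝ (neurons Φ) : Set C(E, ℝ)) := by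
  intro hd
  obtain ⟨e, he⟩ := exists_ne (0 : E)
  obtain ⟨f, hf⟩ := SeparatingDual.exists_eq_one (R := ℝ) he
  let T : Submodule ℝ C(E, ℝ) :=
    { carrier := {u | (fun t : ℝ => u (t • e)) ∈ polyFun m}
      add_mem' := fun hu hv => polyFun_add hu hv
      zero_mem' := zero_mem_polyFun m
      smul_mem' := fun c _ hu => polyFun_const_mul c hu }
  have hT : IsClosed (T : Set C(E, ℝ)) :=
    isClosed_setOf_mem_polyFun m (f := fun (u : C(E, ℝ)) (t : ℝ) => u (t • e))
      fun t => continuous_eval_const _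
  have hle : Submodule.span ℝ (neurons Φ) ≤ T := by
    refine Submodule.span_le.2 fun u hu => ?_
    obtain ⟨ν, g, hg⟩ := hu
    have := mem_polyOnLines_iff.1 hΦ ν
      (g.comp (ContinuousLinearMap.toSpanSingleton ℝ e).toContinuousAffineMap)
    change (fun t : ℝ => u (t • e)) ∈ polyFun m
    simpa [hg] using this
  -- On the line `t • e` this vanishes at `t = 0, …, m` but not at `m + 1`, so it is outside `P_m`.
  let u : C(E, ℝ) := ∏ j ∈ Finset.range (m + 1), ((f : C(E, ℝ)) - ContinuousMap.const E (j : ℝ))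
  have hu : ∀ t : ℝ, u (t • e) = ∏ j ∈ Finset.range (m + 1), (t - j) := fun t => by
    simp [u, hf]
  have huT : u ∈ T := closure_minimal hle hT (hd u)
  have h := mem_polyFun_iff.1 huT (m + 1)
  rw [Finset.sum_eq_zero (fun j hj => by
    rw [hu, Finset.prod_eq_zero hj (sub_self _), zero_mul]), hu] at h
  obtain ⟨j, hj, h0⟩ := Finset.prod_eq_zero_iff.1 h
  have h1 : (j : ℝ) < m + 1 := by exact_mod_cast Finset.mem_range.1 hj
  linarith

theorem dense_span_neurons {Φ : C(E, F)}
    (hΦ : ∀ m, ⇑Φ ∉ polyOnLines E F m) : Dense (Submodule.span ℝ (neurons Φ) : Set C(E, ℝ)) := by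
  have hex : ∀ m, ∃ (ν : StrongDual ℝ F) (h : ℝ →ᴬ[ℝ] E), (fun t => ν (Φ (h t))) ∉ polyFun m := by
    intro m
    by_contra! H
    exact hΦ m (mem_polyOnLines_iff.2 H)
  have main : ∀ (K : Set E), IsCompact K → ∀ (f : C(E, ℝ)) (ε : ℝ), 0 < ε →
      ∃ u ∈ Submodule.span ℝ (neurons Φ), ∀ x ∈ K, dist (f x) (u x) < ε := by
    intro K hK f ε hε
    have : CompactSpace K := isCompact_iff_compactSpace.1 hK
    let r : C(E, ℝ) →ₗ[ℝ] C(K, ℝ) :=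
      { toFun := fun u => u.restrict K, map_add' := fun _ _ => rfl, map_smul' := fun _ _ => rfl }
    let W := ((Submodule.span ℝ (neurons Φ)).map r).topologicalClosure
    have hW : IsClosed (W : Set C(K, ℝ)) := Submodule.isClosed_topologicalClosure _
    let A : Submodule ℝ C(K, ℝ) :=
      { carrier := {l | ∃ a : E →ᴬ[ℝ] ℝ, ∀ x : K, l x = a x}
        add_mem' := by
          rintro _ _ ⟨a, ha⟩ ⟨b, hb⟩
          exact ⟨a + b, fun x => by simp [ha, hb]⟩
        zero_mem' := ⟨0, fun x => rfl⟩
        smul_mem' := by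
          rintro c _ ⟨a, ha⟩
          exact ⟨c • a, fun x => by simp [ha]⟩ }
    have hA : ∀ c : ℝ, ContinuousMap.const K c ∈ A := fun c =>
      ⟨ContinuousAffineMap.const ℝ E c, fun x => rfl⟩
    have hcomp : ∀ (ν : StrongDual ℝ F) (h : ℝ →ᴬ[ℝ] E) (σ : C(ℝ, ℝ)),
        (∀ t, σ t = ν (Φ (h t))) → ∀ l ∈ A, σ.comp l ∈ W := by
      rintro ν h σ hσ l ⟨a, ha⟩
      refine subset_closure ⟨σ.comp a, Submodule.subset_span ⟨ν, h.comp a, fun x => hσ _⟩, ?_⟩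
      ext x
      exact congrArg σ (ha x).symm
    have hpow : ∀ u ∈ A, ∀ k : ℕ, u ^ k ∈ W := by
      intro u hu k
      -- The neuron may depend on `k`. For `k = 0` truncation gives degree `0`, and only `σ ≠ 0` is
      -- needed.
      obtain ⟨ν, h, hνh⟩ := hex (k - 1)
      let σ : C(ℝ, ℝ) := ⟨fun t => ν (Φ (h t)), by fun_prop⟩
      have hσ := hcomp ν h σ fun t => rfl
      cases k with
      | zero =>
        obtain ⟨b, hb⟩ : ∃ b, σ b ≠ 0 := by
          by_contra! H
          exact hνh ((funext H : (fun t => ν (Φ (h t))) = fun _ => 0) ▸ zero_mem_polyFun _)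
        have h1 : u ^ 0 = (σ b)⁻¹ • σ.comp (ContinuousMap.const K b) := by
          ext x
          simp [hb]
        exact h1 ▸ W.smul_mem _ (hσ _ (hA b))
      | succ k => exact pow_succ_mem_of_not_mem_polyFun hW hA hσ hνh hu
    have htop : W = ⊤ := eq_top_of_forall_pow_mem hW (fun x y hxy => by
      obtain ⟨a, ha⟩ := SeparatingDual.exists_separating_of_ne (R := ℝ)
        (Subtype.coe_injective.ne hxy)
      exact ⟨(a : C(E, ℝ)).restrict K, ⟨a.toContinuousAffineMap, fun x => rfl⟩, ha⟩) hpow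
    have hf : r f ∈ W := htop ▸ Submodule.mem_top
    obtain ⟨_, ⟨u, hu, rfl⟩, hdist⟩ := Metric.mem_closure_iff.1 hf ε hε
    exact ⟨u, hu, fun x hx => (ContinuousMap.dist_apply_le_dist (f := r f) (g := r u)
      ⟨x, hx⟩).trans_lt hdist⟩
  intro f
  rw [mem_closure_iff_nhds]
  intro U hU
  obtain ⟨V, hV, hVU⟩ := UniformSpace.mem_nhds_iff.1 hU
  obtain ⟨K, V', hK, hV', hsub⟩ := (ContinuousMap.mem_compactConvergence_entourage_iff V).1 hV
  obtain ⟨ε, hε, hεV⟩ := Metric.mem_uniformity_dist.1 hV'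
  obtain ⟨u, hu, hfu⟩ := main K hK f ε hε
  exact ⟨u, hVU (hsub fun x hx => hεV (hfu x hx)), hu⟩

end Density

theorem mainTheorem1 {E F : Type*}
    [AddCommGroup E] [Module ℝ E] [TopologicalSpace E] [IsTopologicalAddGroup E]
    [ContinuousSMul ℝ E] [LocallyConvexSpace ℝ E] [T2Space E] [Nontrivial E]
    [AddCommGroup F] [Module ℝ F] [TopologicalSpace F] [IsTopologicalAddGroup F]
    [ContinuousSMul ℝ F] [LocallyConvexSpace ℝ F] [T2Space F]
    (Φ : C(E, F)) :
    List.TFAE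
      [IsPolynomialMap Φ,
       ∃ m : ℕ, ∀ (ν : StrongDual ℝ F) (h : ℝ →ᴬ[ℝ] E), (fun t => ν (Φ (h t))) ∈ polyFun m,
       ¬ Dense (Submodule.span ℝ (neurons Φ) : Set C(E, ℝ))] ∧
    (BaireSpace E →
      (∃ τ : TopologicalSpace (StrongDual ℝ F),
        IsLinearTopologyFinerThanWeakStar τ ∧ @BaireSpace (StrongDual ℝ F) τ) →
      List.TFAE
        [IsPolynomialMap Φ,
         ∃ m : ℕ, ∀ (ν : StrongDual ℝ F) (h : ℝ →ᴬ[ℝ] E), (fun t => ν (Φ (h t))) ∈ polyFun m,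
         ¬ Dense (Submodule.span ℝ (neurons Φ) : Set C(E, ℝ)),
         ∀ (ν : StrongDual ℝ F) (h : ℝ →ᴬ[ℝ] E),
           ∃ m : ℕ, (fun t => ν (Φ (h t))) ∈ polyFun m]) := by
  have h12 : IsPolynomialMap Φ ↔ ∃ m : ℕ, ∀ (ν : StrongDual ℝ F) (h : ℝ →ᴬ[ℝ] E),
      (fun t => ν (Φ (h t))) ∈ polyFun m :=
    exists_congr fun m => ⟨fun h => mem_polyOnLines_iff.1 h.mem_polyOnLines,
      fun h => isPolynomialMapOfDegreeLE_of_mem_polyOnLines (mem_polyOnLines_iff.2 h)⟩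
  have h23 : (∃ m : ℕ, ∀ (ν : StrongDual ℝ F) (h : ℝ →ᴬ[ℝ] E),
      (fun t => ν (Φ (h t))) ∈ polyFun m) ↔
      ¬ Dense (Submodule.span ℝ (neurons Φ) : Set C(E, ℝ)) := by
    refine ⟨fun ⟨m, hm⟩ => not_dense_span_neurons (mem_polyOnLines_iff.2 hm), fun hd => ?_⟩
    by_contra! H
    refine hd (dense_span_neurons fun m hm => ?_)
    obtain ⟨ν, h, hνh⟩ := H m
    exact hνh (mem_polyOnLines_iff.1 hm ν h)
  refine ⟨?_, ?_⟩
  · tfae_have 1 ↔ 2 := h12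
    tfae_have 2 ↔ 3 := h23
    tfae_finish
  · rintro hE ⟨τ, hτ, hB⟩
    tfae_have 1 ↔ 2 := h12
    tfae_have 2 ↔ 3 := h23
    tfae_have 2 → 4 := fun ⟨m, hm⟩ ν h => ⟨m, hm ν h⟩
    tfae_have 4 → 2 := fun H => by
      obtain ⟨m, hm⟩ := exists_mem_polyOnLines_of_baire hτ hB Φ.continuous
        fun ν => (forall_continuousAffineMap_iff
          (P := fun l => ∃ m, (fun t => ν (Φ (l t))) ∈ polyFun m)).1 (H ν)
      exact ⟨m, mem_polyOnLines_iff.1 hm⟩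
    tfae_finish
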